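/- For a real $m\times n$ matrix $M$ let $\sigma_1(M)\ge\sigma_2(M)\ge\cdots\ge\sigma_r(M)\ge 0$, $r=\min\{m,n\}$, be its singular values (with $\sigma_j(M)=0$ for $j>r$), and let $\|M\|_2$ be its Euclidean operator norm. For an integer $p\ge1$ the Schatten $p$-norm is $\|M\|_p=\bigl(\sigma_1(M)^p+\cdots+\sigma_r(M)^p\bigr)^{1/p}$, and $\|M\|_\infty=\sigma_1(M)$. For orthogonal projectors $P,Q\in\mathbb{R}^{m\times m}$, choose matrices $Z$ and $Y$ whose columns are orthonormal bases of $\mathrm{range}(P)$ and $\mathrm{range}(Q)$. The principal angles $\theta_1,\dots,\theta_s\in[0,\pi/2]$, $s=\min\{\mathrm{rank}\,P,\mathrm{rank}\,Q\}$, between these ranges are defined by $\cos\theta_j=\sigma_j(Z^TY)$, and $\sin\Theta(P,Q)=\mathrm{diag}(\sin\theta_1,\dots,\sin\theta_s)$. Let $A\in\mathbb{R}^{m\times n}$ and $1\le k\le\min\{m,n\}$ be such that $\sigma_k(A)>\sigma_{k+1}(A)$. Let $A=U\Sigma V^T$ be any full singular value decomposition, with $U\in\mathbb{R}^{m\times m}$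 and $V\in\mathbb{R}^{n\times n}$ orthogonal and $\Sigma\in\mathbb{R}^{m\times n}$ diagonal with diagonal entries $\sigma_1(A),\dots,\sigma_r(A)$. Let $U_k$ and $V_k$ be the leading $k$ columns of $U$ and $V$, and put $\Sigma_k=\mathrm{diag}(\sigma_1(A),\dots,\sigma_k(A))$, $A_k=U_k\Sigma_kV_k^T$, $A_k^\dagger=V_k\Sigma_k^{-1}U_k^T$. Let $P_U=A_kA_k^\dagger$, the orthogonal projector onto the dominant $k$-dimensional left singular subspace of $A$. Let $P\in\mathbb{R}^{m\times m}$ be an orthogonal projector ($P^2=P=P^T$) with $k\le\mathrm{rank}(P)<m-k$. Then, for every integer $p\ge1$ and for $p=\infty$, $$\sigma_k(A)\,\|\sin\Theta(P,P_U)\|_p\ \le\ \|(I-P)A\|_p\ \le\ \|A\|_2\,\|\sin\Theta(P,P_U)\|_p+\|A-A_k\|_p .$$ -/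

import Mathlib

open scoped Matrix

namespace SchattenSin

/-- The singular values of a real matrix in non-increasing order, numbered from `0`:
`sv M j` is `σ_{j+1}(M)`. It is `0` for `j ≥ min m n`. -/
noncomputable def sv {m n : ℕ} (M : Matrix (Fin m) (Fin n) ℝ) (j : ℕ) : ℝ :=
  (Matrix.toEuclideanLin M).singularValues j

/-- The two-norm, i.e. the operator norm with respect to the Euclidean vector norms. -/
noncomputable def twoNorm {m n : ℕ} (M : Matrix (Fin m) (Fin n) ℝ) : ℝ :=
  ‖LinearMap.toContinuousLinearMap (Matrix.toEuclideanLin M)‖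

/-- The Schatten `p`-norm for an integer `p ≥ 1` or `p = ∞`. -/
noncomputable def schattenNorm {m n : ℕ} (p : ℕ∞) (M : Matrix (Fin m) (Fin n) ℝ) : ℝ :=
  if p = ⊤ then sv M 0
  else (∑ j ∈ Finset.range (min m n), sv M j ^ p.toNat) ^ (1 / (p.toNat : ℝ))

/-- `P` is an orthogonal projector: idempotent and symmetric. -/
def IsOrthogonalProjector {m : ℕ} (P : Matrix (Fin m) (Fin m) ℝ) : Prop :=
  P * P = P ∧ Pᵀ = P

/-- The rectangular diagonal matrix of all singular values of `A`. -/
noncomputable def sigmaMatrix {m n : ℕ} (A : Matrix (Fin m) (Fin n) ℝ) :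
    Matrix (Fin m) (Fin n) ℝ :=
  Matrix.of fun i j => if (i : ℕ) = (j : ℕ) then sv A i else 0

/-- `A = U Σ Vᵀ` is a full singular value decomposition of `A`. -/
structure IsFullSVD {m n : ℕ} (A : Matrix (Fin m) (Fin n) ℝ)
    (U : Matrix (Fin m) (Fin m) ℝ) (V : Matrix (Fin n) (Fin n) ℝ) : Prop where
  left_orthogonal : U ∈ Matrix.orthogonalGroup (Fin m) ℝ
  right_orthogonal : V ∈ Matrix.orthogonalGroup (Fin n) ℝ
  decomposition : A = U * sigmaMatrix A * Vᵀ

/-- The leading `k` columns of a matrix. -/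
def leadingCols {m l k : ℕ} (h : k ≤ l) (M : Matrix (Fin m) (Fin l) ℝ) :
    Matrix (Fin m) (Fin k) ℝ :=
  M.submatrix id (Fin.castLE h)

/-- The best rank-`k` approximation `A_k = U_k Σ_k V_kᵀ` obtained from the full SVD given by
`U` and `V`. -/
noncomputable def truncation {m n k : ℕ} (hm : k ≤ m) (hn : k ≤ n)
    (A : Matrix (Fin m) (Fin n) ℝ)
    (U : Matrix (Fin m) (Fin m) ℝ) (V : Matrix (Fin n) (Fin n) ℝ) :
    Matrix (Fin m) (Fin n) ℝ :=
  leadingCols hm U * Matrix.diagonal (fun j : Fin k => sv A j) * (leadingCols hn V)ᵀ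

/-- The pseudo-inverse `A_k^† = V_k Σ_k⁻¹ U_kᵀ` of `A_k`, for `k ≤ rank A`. -/
noncomputable def truncationPinv {m n k : ℕ} (hm : k ≤ m) (hn : k ≤ n)
    (A : Matrix (Fin m) (Fin n) ℝ)
    (U : Matrix (Fin m) (Fin m) ℝ) (V : Matrix (Fin n) (Fin n) ℝ) :
    Matrix (Fin n) (Fin m) ℝ :=
  leadingCols hn V * Matrix.diagonal (fun j : Fin k => (sv A j)⁻¹) * (leadingCols hm U)ᵀ

/-- The projector `A_k A_k^†` onto the dominant `k`-dimensional left singular subspace. -/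
noncomputable def dominantProjector {m n k : ℕ} (hm : k ≤ m) (hn : k ≤ n)
    (A : Matrix (Fin m) (Fin n) ℝ)
    (U : Matrix (Fin m) (Fin m) ℝ) (V : Matrix (Fin n) (Fin n) ℝ) :
    Matrix (Fin m) (Fin m) ℝ :=
  truncation hm hn A U V * truncationPinv hm hn A U V

/-- The column space of `P` as a subspace of Euclidean space. -/
noncomputable def rangeOf {m : ℕ} (P : Matrix (Fin m) (Fin m) ℝ) :
    Submodule ℝ (EuclideanSpace ℝ (Fin m)) :=
  LinearMap.range (Matrix.toEuclideanLin P)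

/-- A matrix whose columns are an orthonormal basis of the column space of `P`. -/
noncomputable def basisMatrix {m : ℕ} (P : Matrix (Fin m) (Fin m) ℝ) :
    Matrix (Fin m) (Fin (Module.finrank ℝ (rangeOf P))) ℝ :=
  Matrix.of fun i j => (stdOrthonormalBasis ℝ (rangeOf P) j : EuclideanSpace ℝ (Fin m)) i

/-- The principal angles `θ_{j+1} ∈ [0, π/2]` between the column spaces of `P` and `Q`, for
`j < min (rank P) (rank Q)`: if the columns of `Z` and `Y` are orthonormal bases of these spaces,
then the numbers `cos θ_{j+1}` are the singular values of `Zᵀ Y`. -/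
noncomputable def principalAngle {m : ℕ} (P Q : Matrix (Fin m) (Fin m) ℝ) (j : ℕ) : ℝ :=
  Real.arccos (sv ((basisMatrix P)ᵀ * basisMatrix Q) j)

/-- The diagonal matrix `sin Θ(P, Q)` of the sines of all principal angles between the column
spaces of `P` and `Q`. -/
noncomputable def sinTheta {m : ℕ} (P Q : Matrix (Fin m) (Fin m) ℝ) :
    Matrix (Fin (min P.rank Q.rank)) (Fin (min P.rank Q.rank)) ℝ :=
  Matrix.diagonal fun j => Real.sin (principalAngle P Q j)

end SchattenSin

/-!
The sines of the principal angles are the singular values of `(1 - P) Y`, where the columns of `Y`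
are an orthonormal basis of the range of the dominant projector `P_U`: with `Z` a basis matrix for
`P` and `T = Zᵀ Y`, the Gram matrix of `(1 - P) Y` is `1 - TᵀT`, so a basis of right singular
vectors of `T` has pairwise orthogonal images of lengths `sin θ_j`. This uses `k ≤ rank P`, which
makes the number of principal angles equal to the number of columns of `Y`. Hence
`‖sin Θ(P, P_U)‖ = ‖(1 - P) P_U‖` in each Schatten norm (`schattenNorm_sinTheta`).

The lower bound follows from `(1 - P) P_U = ((1 - P) A) A_k^†` and `‖A_k^†‖₂ ≤ 1 / σ_k`; the upper
bound from `(1 - P) A = ((1 - P) P_U) A + (1 - P) (A - A_k)`, which holds as `P_U A = A_k`. What is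
needed are the ideal property of the Schatten norms (`schattenNorm_mul_le`,
`schattenNorm_contraction_mul_le`) and the triangle inequality (`schattenNorm_add_le`).

For `p = ∞` the Schatten norm is the operator norm (`schattenNorm_top`). For finite `p` everything
rests on one inequality, `sum_abs_inner_pow_le`: if `e` and `f` satisfy Bessel's inequality, then
`∑ |⟪f_i, M e_i⟫| ^ p ≤ ∑ σ_j(M) ^ p`. Indeed `|⟪f_i, M e_i⟫| ≤ ∑ w_ij σ_j` with `w` doubly
substochastic, and `t ↦ t ^ p` is convex. Equality is attained at the singular vectors of `M`, so the
Schatten norm is a maximum of `ℓ^p` norms of linear functions of `M`, and the triangle inequality is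
Minkowski's. The ideal property holds because contractions preserve Bessel families.
-/

open scoped Matrix RealInnerProductSpace

namespace SchattenSin

/-! ### Bessel families and maps with orthogonal images -/

section Bessel

variable {E F : Type*} [NormedAddCommGroup E] [InnerProductSpace ℝ E]
  [NormedAddCommGroup F] [InnerProductSpace ℝ F]
  {ι κ : Type*} [Fintype ι] [Fintype κ]

/-- A finite family of vectors satisfying Bessel's inequality. Unlike orthonormal families, these
are stable under contractions, and the vectors may vanish. -/
def IsBessel (e : ι → E) : Prop := ∀ x : E, ∑ i, ⟪e i, x⟫ ^ 2 ≤ ‖x‖ ^ 2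

theorem IsBessel.norm_le_one {e : ι → E} (he : IsBessel e) (i : ι) : ‖e i‖ ≤ 1 := by
  have h1 : ⟪e i, e i⟫ ^ 2 ≤ ‖e i‖ ^ 2 :=
    (Finset.single_le_sum (f := fun j => ⟪e j, e i⟫ ^ 2) (fun j _ => sq_nonneg _)
      (Finset.mem_univ i)).trans (he (e i))
  rw [real_inner_self_eq_norm_sq] at h1
  by_contra! h
  nlinarith [norm_nonneg (e i), sq_nonneg (‖e i‖ ^ 2 - 1)]

theorem _root_.OrthonormalBasis.isBessel (v : OrthonormalBasis ι ℝ E) : IsBessel v := by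
  intro x
  have := v.sum_sq_norm_inner_right x
  simp only [Real.norm_eq_abs, sq_abs] at this
  exact this.le

theorem norm_adjoint_le [FiniteDimensional ℝ E] [FiniteDimensional ℝ F] (C : E →ₗ[ℝ] F)
    (hC : ∀ x, ‖C x‖ ≤ ‖x‖) (y : F) : ‖C.adjoint y‖ ≤ ‖y‖ := by
  have h : ‖C.adjoint y‖ ^ 2 ≤ ‖y‖ * ‖C.adjoint y‖ := by
    rw [← real_inner_self_eq_norm_sq, LinearMap.adjoint_inner_left]
    exact (real_inner_le_norm _ _).trans (by gcongr; exact hC _)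
  by_contra! hlt
  nlinarith [norm_nonneg y]

theorem IsBessel.map [FiniteDimensional ℝ E] [FiniteDimensional ℝ F] {e : ι → E}
    (he : IsBessel e) (C : E →ₗ[ℝ] F) (hC : ∀ x, ‖C x‖ ≤ ‖x‖) :
    IsBessel fun i => C (e i) := by
  intro y
  simp only [← LinearMap.adjoint_inner_right]
  exact (he _).trans (by gcongr; exact norm_adjoint_le C hC y)

/-- The images of an orthonormal basis, when pairwise orthogonal, become a Bessel family after
normalization; vanishing images stay `0` because `0⁻¹ = 0`. -/
theorem isBessel_normalized_images (T : E →ₗ[ℝ] F) (v : ι → E)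
    (hv : Pairwise fun i j => ⟪T (v i), T (v j)⟫ = 0) :
    IsBessel fun i => ‖T (v i)‖⁻¹ • T (v i) := by
  classical
  intro x
  set u : ι → F := fun i => ‖T (v i)‖⁻¹ • T (v i)
  set z := ∑ i, ⟪u i, x⟫ • u i with hz
  have huu : ∀ i j, ⟪u i, x⟫ * ⟪u i, u j⟫ = if i = j then ⟪u i, x⟫ else 0 := by
    intro i j
    split_ifs with h
    · subst h
      by_cases h0 : T (v i) = 0
      · simp [u, h0]
      · have : ‖u i‖ = 1 := by
          simp [u, norm_smul, h0]
        rw [real_inner_self_eq_norm_sq, this]; ring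
    · simp [u, inner_smul_left, inner_smul_right, hv h]
  have h1 : ⟪z, x⟫ = ∑ i, ⟪u i, x⟫ ^ 2 := by
    simp [hz, sum_inner, inner_smul_left, sq]
  have h2 : ⟪z, z⟫ = ∑ i, ⟪u i, x⟫ ^ 2 := by
    conv_lhs => rw [hz]
    rw [inner_sum]
    refine Finset.sum_congr rfl fun j _ => ?_
    simp [sum_inner, inner_smul_left, inner_smul_right, huu, sq]
  have h3 := real_inner_self_nonneg (x := x - z)
  rw [real_inner_sub_sub_self, h2, real_inner_comm z x, h1, real_inner_self_eq_norm_sq] at h3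
  change ∑ i, ⟪u i, x⟫ ^ 2 ≤ _
  linarith

/-- Jensen's inequality for powers with weights of total mass at most one. -/
theorem pow_sum_mul_le_sum_mul_pow (w z : ι → ℝ) (hw : ∀ i, 0 ≤ w i) (hw1 : ∑ i, w i ≤ 1)
    (hz : ∀ i, 0 ≤ z i) {p : ℕ} (hp : p ≠ 0) :
    (∑ i, w i * z i) ^ p ≤ ∑ i, w i * z i ^ p := by
  -- The missing mass is put on an additional point where `z` vanishes.
  have := Real.pow_arith_mean_le_arith_mean_pow (Finset.univ : Finset (Option ι))
    (fun o => o.elim (1 - ∑ i, w i) w) (fun o => o.elim 0 z)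
    (by rintro (_ | i) -; exacts [by simpa using hw1, hw i])
    (by simp [Fintype.sum_option])
    (by rintro (_ | i) -; exacts [le_rfl, hz i]) p
  simpa [Fintype.sum_option, hp] using this

/-- The key inequality. The coefficients `⟪f i, u j⟫ * ⟪v j, e i⟫` expressing `⟪f i, T (e i)⟫`
in terms of the norms `‖T (v j)‖`, with `u j` the normalized vector `T (v j)`, are dominated
by a doubly substochastic matrix. -/
theorem sum_abs_inner_pow_le (T : E →ₗ[ℝ] F) (v : OrthonormalBasis ι ℝ E)
    (hv : Pairwise fun i j => ⟪T (v i), T (v j)⟫ = 0) {e : κ → E} {f : κ → F}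
    (he : IsBessel e) (hf : IsBessel f) {p : ℕ} (hp : p ≠ 0) :
    ∑ i, |⟪f i, T (e i)⟫| ^ p ≤ ∑ j, ‖T (v j)‖ ^ p := by
  set u : ι → F := fun j => ‖T (v j)‖⁻¹ • T (v j)
  have hu : IsBessel u := isBessel_normalized_images T v hv
  have hTu : ∀ j, T (v j) = ‖T (v j)‖ • u j := by
    intro j
    by_cases h0 : T (v j) = 0
    · simp [h0]
    · simp [u, h0]
  let w : κ → ι → ℝ := fun i j => (⟪u j, f i⟫ ^ 2 + ⟪v j, e i⟫ ^ 2) / 2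
  have hw : ∀ i j, 0 ≤ w i j := fun i j => by positivity
  have hrow : ∀ i, ∑ j, w i j ≤ 1 := by
    intro i
    rw [← Finset.sum_div, Finset.sum_add_distrib]
    have h1 := hu (f i)
    have h2 := v.isBessel (e i)
    have h3 : ‖f i‖ ^ 2 ≤ 1 := pow_le_one₀ (norm_nonneg _) (hf.norm_le_one i)
    have h4 : ‖e i‖ ^ 2 ≤ 1 := pow_le_one₀ (norm_nonneg _) (he.norm_le_one i)
    linarith
  have hcol : ∀ j, ∑ i, w i j ≤ 1 := by
    intro j
    rw [← Finset.sum_div, Finset.sum_add_distrib]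
    have h1 := hf (u j)
    have h2 := he (v j)
    have h3 : ‖u j‖ ^ 2 ≤ 1 := pow_le_one₀ (norm_nonneg _) (hu.norm_le_one j)
    simp only [v.norm_eq_one] at h2
    simp only [real_inner_comm (f _), real_inner_comm (e _)] at h1 h2 ⊢
    linarith
  have hle : ∀ i, |⟪f i, T (e i)⟫| ≤ ∑ j, w i j * ‖T (v j)‖ := by
    intro i
    have : ⟪f i, T (e i)⟫ = ∑ j, ⟪u j, f i⟫ * ⟪v j, e i⟫ * ‖T (v j)‖ := by
      conv_lhs => rw [← v.sum_repr' (e i), map_sum, inner_sum]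
      refine Finset.sum_congr rfl fun j _ => ?_
      rw [map_smul, inner_smul_right, hTu j, inner_smul_right, real_inner_comm (u j) (f i),
        ← hTu j]
      ring
    rw [this]
    refine (Finset.abs_sum_le_sum_abs _ _).trans (Finset.sum_le_sum fun j _ => ?_)
    rw [abs_mul, abs_of_nonneg (norm_nonneg (T (v j)))]
    refine mul_le_mul_of_nonneg_right ?_ (norm_nonneg _)
    rw [abs_le]
    constructor <;> simp only [w] <;>
      nlinarith [sq_nonneg (⟪u j, f i⟫ + ⟪v j, e i⟫), sq_nonneg (⟪u j, f i⟫ - ⟪v j, e i⟫)]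
  calc ∑ i, |⟪f i, T (e i)⟫| ^ p ≤ ∑ i, ∑ j, w i j * ‖T (v j)‖ ^ p :=
        Finset.sum_le_sum fun i _ => (pow_le_pow_left₀ (abs_nonneg _) (hle i) p).trans
          (pow_sum_mul_le_sum_mul_pow _ _ (hw i) (hrow i) (fun _ => norm_nonneg _) hp)
    _ = ∑ j, (∑ i, w i j) * ‖T (v j)‖ ^ p := by
        rw [Finset.sum_comm]; simp only [Finset.sum_mul]
    _ ≤ ∑ j, ‖T (v j)‖ ^ p := Finset.sum_le_sum fun j _ =>
        mul_le_of_le_one_left (by positivity) (hcol j)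

/-- Pythagoras for a map sending an orthonormal basis to pairwise orthogonal vectors. -/
theorem norm_sq_map_eq_sum (T : E →ₗ[ℝ] F) (v : OrthonormalBasis ι ℝ E)
    (hv : Pairwise fun i j => ⟪T (v i), T (v j)⟫ = 0) (x : E) :
    ‖T x‖ ^ 2 = ∑ j, ⟪v j, x⟫ ^ 2 * ‖T (v j)‖ ^ 2 := by
  classical
  have h : T x = ∑ j, ⟪v j, x⟫ • T (v j) := by
    conv_lhs => rw [← v.sum_repr' x, map_sum]
    simp
  have hvv : ∀ i j, ⟪T (v i), T (v j)⟫ = if i = j then ‖T (v i)‖ ^ 2 else 0 := by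
    intro i j
    split_ifs with hij
    · rw [← hij, real_inner_self_eq_norm_sq]
    · exact hv hij
  rw [← real_inner_self_eq_norm_sq, h, inner_sum]
  refine Finset.sum_congr rfl fun j _ => ?_
  simp [sum_inner, inner_smul_left, inner_smul_right, hvv]
  ring

end Bessel

/-! ### Singular values and Schatten norms -/

section SingularVectors

variable {m n l : ℕ}

/-- A basis of right singular vectors. -/
theorem exists_basis_singular (M : Matrix (Fin m) (Fin n) ℝ) :
    ∃ v : OrthonormalBasis (Fin n) ℝ (EuclideanSpace ℝ (Fin n)),
      (Pairwise fun i j => ⟪M.toEuclideanLin (v i), M.toEuclideanLin (v j)⟫ = 0) ∧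
      ∀ j, ‖M.toEuclideanLin (v j)‖ = sv M j := by
  set T := M.toEuclideanLin
  have hn : Module.finrank ℝ (EuclideanSpace ℝ (Fin n)) = n := by simp
  set v := T.isSymmetric_adjoint_comp_self.eigenvectorBasis hn
  have key : ∀ i j, ⟪T (v i), T (v j)⟫ = T.singularValues j ^ 2 * ⟪v i, v j⟫ := by
    intro i j
    rw [← LinearMap.adjoint_inner_right, T.sq_singularValues_fin hn, ← inner_smul_right]
    congr 1
    exact T.isSymmetric_adjoint_comp_self.apply_eigenvectorBasis hn j
  refine ⟨v, fun i j hij => ?_, fun j => ?_⟩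
  · dsimp only
    rw [key, v.inner_eq_zero hij, mul_zero]
  · have h := key j j
    rw [real_inner_self_eq_norm_sq, real_inner_self_eq_norm_sq, v.norm_eq_one, one_pow,
      mul_one] at h
    exact (sq_eq_sq₀ (norm_nonneg _) (T.singularValues_nonneg _)).1 h

/-- Left and right singular vectors pairing to the singular values. The left ones are only a
Bessel family, those belonging to the singular value zero being taken to be `0`. -/
theorem exists_singular_pairs (M : Matrix (Fin m) (Fin n) ℝ) :
    ∃ (v : Fin n → EuclideanSpace ℝ (Fin n)) (u : Fin n → EuclideanSpace ℝ (Fin m)),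
      IsBessel v ∧ IsBessel u ∧ ∀ j : Fin n, sv M j = ⟪u j, M.toEuclideanLin (v j)⟫ := by
  obtain ⟨v, hv, hs⟩ := exists_basis_singular M
  refine ⟨v, _, v.isBessel, isBessel_normalized_images _ v hv, fun j => ?_⟩
  rw [← hs j, real_inner_smul_left, real_inner_self_eq_norm_sq]
  by_cases h0 : ‖M.toEuclideanLin (v j)‖ = 0
  · simp [h0]
  · field_simp

theorem sv_nonneg (M : Matrix (Fin m) (Fin n) ℝ) (j : ℕ) : 0 ≤ sv M j :=
  LinearMap.singularValues_nonneg _ j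

theorem sv_eq_zero (M : Matrix (Fin m) (Fin n) ℝ) {j : ℕ} (hj : min m n ≤ j) : sv M j = 0 := by
  rcases min_le_iff.1 hj with h | h
  · refine LinearMap.singularValues_eq_zero_iff_le_finrank_range _ |>.2 (le_trans ?_ h)
    simpa using Submodule.finrank_le M.toEuclideanLin.range
  · exact LinearMap.singularValues_of_finrank_le _ (by simpa using h)

theorem schattenNorm_natCast (M : Matrix (Fin m) (Fin n) ℝ) {p : ℕ} (hp : p ≠ 0) :
    schattenNorm p M = (∑ j : Fin n, sv M j ^ p) ^ (1 / (p : ℝ)) := by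
  rw [schattenNorm, if_neg (by simp), ENat.toNat_natCast, Fin.sum_univ_eq_sum_range (sv M · ^ p)]
  congr 1
  refine Finset.sum_subset (by simp) fun j _ hj => ?_
  rw [sv_eq_zero M (by rwa [Finset.mem_range, not_lt] at hj), zero_pow hp]

theorem norm_toEuclideanLin_le (M : Matrix (Fin m) (Fin n) ℝ) (x : EuclideanSpace ℝ (Fin n)) :
    ‖M.toEuclideanLin x‖ ≤ twoNorm M * ‖x‖ :=
  (LinearMap.toContinuousLinearMap M.toEuclideanLin).le_opNorm x

theorem twoNorm_le (M : Matrix (Fin m) (Fin n) ℝ) {c : ℝ} (hc : 0 ≤ c)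
    (h : ∀ x, ‖M.toEuclideanLin x‖ ≤ c * ‖x‖) : twoNorm M ≤ c :=
  ContinuousLinearMap.opNorm_le_bound _ hc h

theorem sv_le_twoNorm (M : Matrix (Fin m) (Fin n) ℝ) (j : ℕ) : sv M j ≤ twoNorm M := by
  by_cases hj : j < n
  · obtain ⟨v, -, hs⟩ := exists_basis_singular M
    have := norm_toEuclideanLin_le M (v ⟨j, hj⟩)
    rwa [hs, v.norm_eq_one, mul_one] at this
  · rw [sv_eq_zero M (min_le_of_right_le (not_lt.1 hj))]
    exact norm_nonneg _

theorem schattenNorm_top (M : Matrix (Fin m) (Fin n) ℝ) : schattenNorm ⊤ M = twoNorm M := by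
  rw [schattenNorm, if_pos rfl]
  refine le_antisymm (sv_le_twoNorm M 0) (twoNorm_le M (sv_nonneg M 0) fun x => ?_)
  obtain ⟨v, hv, hs⟩ := exists_basis_singular M
  refine (sq_le_sq₀ (norm_nonneg _) (mul_nonneg (sv_nonneg M 0) (norm_nonneg _))).1 ?_
  rw [norm_sq_map_eq_sum _ v hv, mul_pow]
  calc ∑ j, ⟪v j, x⟫ ^ 2 * ‖M.toEuclideanLin (v j)‖ ^ 2
      ≤ ∑ j, ⟪v j, x⟫ ^ 2 * sv M 0 ^ 2 := by
        refine Finset.sum_le_sum fun j _ => ?_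
        rw [hs]
        gcongr
        · exact sv_nonneg M j
        · exact LinearMap.singularValues_antitone _ (Nat.zero_le _)
    _ = sv M 0 ^ 2 * ∑ j, ⟪v j, x⟫ ^ 2 := by rw [← Finset.sum_mul, mul_comm]
    _ ≤ sv M 0 ^ 2 * ‖x‖ ^ 2 := by gcongr; exact v.isBessel x

theorem sum_abs_inner_pow_le_sum_sv_pow (M : Matrix (Fin m) (Fin n) ℝ) {κ : Type*} [Fintype κ]
    {e : κ → EuclideanSpace ℝ (Fin n)} {f : κ → EuclideanSpace ℝ (Fin m)}
    (he : IsBessel e) (hf : IsBessel f) {p : ℕ} (hp : p ≠ 0) :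
    ∑ i, |⟪f i, M.toEuclideanLin (e i)⟫| ^ p ≤ ∑ j : Fin n, sv M j ^ p := by
  obtain ⟨v, hv, hs⟩ := exists_basis_singular M
  simpa only [hs] using sum_abs_inner_pow_le M.toEuclideanLin v hv he hf hp

/-- The singular values of `M` can be replaced, in power sums, by the lengths of the images of any
orthonormal basis with pairwise orthogonal images. Both inequalities are instances of
`sum_abs_inner_pow_le`. -/
theorem sum_sv_pow_eq (M : Matrix (Fin m) (Fin n) ℝ) {ι : Type*} [Fintype ι]
    (v : OrthonormalBasis ι ℝ (EuclideanSpace ℝ (Fin n)))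
    (hv : Pairwise fun i j => ⟪M.toEuclideanLin (v i), M.toEuclideanLin (v j)⟫ = 0)
    {p : ℕ} (hp : p ≠ 0) :
    ∑ j : Fin n, sv M j ^ p = ∑ j, ‖M.toEuclideanLin (v j)‖ ^ p := by
  apply le_antisymm
  · obtain ⟨e, f, he, hf, hs⟩ := exists_singular_pairs M
    have := sum_abs_inner_pow_le M.toEuclideanLin v hv he hf hp
    simpa only [← hs, abs_of_nonneg (sv_nonneg M _)] using this
  · have := sum_abs_inner_pow_le_sum_sv_pow M v.isBessel
      (isBessel_normalized_images M.toEuclideanLin v hv) hp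
    refine le_of_eq_of_le (Finset.sum_congr rfl fun j _ => ?_) this
    rw [real_inner_smul_left, real_inner_self_eq_norm_sq]
    congr 1
    by_cases h0 : ‖M.toEuclideanLin (v j)‖ = 0
    · simp [h0]
    · rw [sq, inv_mul_cancel_left₀ h0, abs_norm]

/-- Two matrices mapping orthonormal bases to pairwise orthogonal vectors of the same lengths have
the same Schatten norms. -/
theorem schattenNorm_eq_of_orthogonal_images {m' : ℕ} {M : Matrix (Fin m) (Fin n) ℝ}
    {N : Matrix (Fin m') (Fin n) ℝ}
    (v w : OrthonormalBasis (Fin n) ℝ (EuclideanSpace ℝ (Fin n)))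
    (hv : Pairwise fun i j => ⟪M.toEuclideanLin (v i), M.toEuclideanLin (v j)⟫ = 0)
    (hw : Pairwise fun i j => ⟪N.toEuclideanLin (w i), N.toEuclideanLin (w j)⟫ = 0)
    (h : ∀ j, ‖M.toEuclideanLin (v j)‖ = ‖N.toEuclideanLin (w j)‖) {p : ℕ∞} (hp : 1 ≤ p) :
    schattenNorm p M = schattenNorm p N := by
  induction p using ENat.recTopCoe with
  | top =>
    -- The isometry exchanging the two bases intertwines the two quadratic forms.
    have aux : ∀ {a b : ℕ} (M : Matrix (Fin a) (Fin n) ℝ) (N : Matrix (Fin b) (Fin n) ℝ)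
        (v w : OrthonormalBasis (Fin n) ℝ (EuclideanSpace ℝ (Fin n))),
        (Pairwise fun i j => ⟪M.toEuclideanLin (v i), M.toEuclideanLin (v j)⟫ = 0) →
        (Pairwise fun i j => ⟪N.toEuclideanLin (w i), N.toEuclideanLin (w j)⟫ = 0) →
        (∀ j, ‖M.toEuclideanLin (v j)‖ = ‖N.toEuclideanLin (w j)‖) →
        twoNorm M ≤ twoNorm N := by
      intro a b M N v w hv hw h
      refine twoNorm_le M (norm_nonneg _) fun x => ?_
      let y := w.repr.symm (v.repr x)
      have hy : ‖y‖ = ‖x‖ := by simp [y]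
      have hin : ∀ j, ⟪w j, y⟫ = ⟪v j, x⟫ := fun j => by
        rw [← w.repr_apply_apply, ← v.repr_apply_apply]; simp [y]
      have hN : ‖M.toEuclideanLin x‖ = ‖N.toEuclideanLin y‖ := by
        refine (sq_eq_sq₀ (norm_nonneg _) (norm_nonneg _)).1 ?_
        rw [norm_sq_map_eq_sum _ v hv, norm_sq_map_eq_sum _ w hw]
        simp only [hin, h]
      rw [hN, ← hy]
      exact norm_toEuclideanLin_le N y
    rw [schattenNorm_top, schattenNorm_top]
    exact le_antisymm (aux M N v w hv hw h) (aux N M w v hw hv fun j => (h j).symm)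
  | coe p =>
    have hp0 : p ≠ 0 := by
      rintro rfl
      simp at hp
    rw [schattenNorm_natCast M hp0, schattenNorm_natCast N hp0, sum_sv_pow_eq M v hv hp0,
      sum_sv_pow_eq N w hw hp0]
    simp only [h]

theorem toEuclideanLin_mul_apply (M : Matrix (Fin m) (Fin n) ℝ) (N : Matrix (Fin n) (Fin l) ℝ)
    (x : EuclideanSpace ℝ (Fin l)) :
    (M * N).toEuclideanLin x = M.toEuclideanLin (N.toEuclideanLin x) := by
  simp [Matrix.toLpLin_apply]

theorem inner_toEuclideanLin_left (M : Matrix (Fin m) (Fin n) ℝ) (x : EuclideanSpace ℝ (Fin n))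
    (y : EuclideanSpace ℝ (Fin m)) :
    ⟪M.toEuclideanLin x, y⟫ = ⟪x, Mᵀ.toEuclideanLin y⟫ := by
  rw [← Matrix.conjTranspose_eq_transpose_of_trivial, Matrix.toEuclideanLin_conjTranspose_eq_adjoint,
    LinearMap.adjoint_inner_right]

theorem norm_transpose_toEuclideanLin_le (M : Matrix (Fin m) (Fin n) ℝ)
    (hM : ∀ x, ‖M.toEuclideanLin x‖ ≤ ‖x‖) (y : EuclideanSpace ℝ (Fin m)) :
    ‖Mᵀ.toEuclideanLin y‖ ≤ ‖y‖ := by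
  rw [← Matrix.conjTranspose_eq_transpose_of_trivial, Matrix.toEuclideanLin_conjTranspose_eq_adjoint]
  exact norm_adjoint_le _ hM y

/-- Minkowski's inequality is applied to the pairings of `M` and of `N` with the singular vectors of
`M + N`. -/
theorem schattenNorm_add_le (M N : Matrix (Fin m) (Fin n) ℝ) {p : ℕ∞} (hp : 1 ≤ p) :
    schattenNorm p (M + N) ≤ schattenNorm p M + schattenNorm p N := by
  induction p using ENat.recTopCoe with
  | top =>
    simp only [schattenNorm_top, twoNorm, map_add]
    exact norm_add_le _ _
  | coe p =>
    have hp1 : 1 ≤ p := by exact_mod_cast hp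
    have hp0 : p ≠ 0 := by omega
    simp only [schattenNorm_natCast _ hp0]
    obtain ⟨e, f, he, hf, hs⟩ := exists_singular_pairs (M + N)
    have hmink := Real.Lp_add_le Finset.univ (fun j => ⟪f j, M.toEuclideanLin (e j)⟫)
      (fun j => ⟪f j, N.toEuclideanLin (e j)⟫) (p := (p : ℝ)) (by exact_mod_cast hp1)
    simp only [Real.rpow_natCast] at hmink
    calc (∑ j : Fin n, sv (M + N) j ^ p) ^ (1 / (p : ℝ))
        = (∑ j, |⟪f j, M.toEuclideanLin (e j)⟫ + ⟪f j, N.toEuclideanLin (e j)⟫| ^ p)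
            ^ (1 / (p : ℝ)) := by
          congr 1
          refine Finset.sum_congr rfl fun j _ => ?_
          rw [← inner_add_right, ← LinearMap.add_apply, ← map_add, ← hs,
            abs_of_nonneg (sv_nonneg _ _)]
      _ ≤ _ := hmink
      _ ≤ _ := by
          gcongr ?_ ^ _ + ?_ ^ _
          · exact sum_abs_inner_pow_le_sum_sv_pow M he hf hp0
          · exact sum_abs_inner_pow_le_sum_sv_pow N he hf hp0

theorem schattenNorm_mul_le (M : Matrix (Fin m) (Fin n) ℝ) (N : Matrix (Fin n) (Fin l) ℝ) {c : ℝ}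
    (hc : 0 < c) (hN : ∀ x, ‖N.toEuclideanLin x‖ ≤ c * ‖x‖) {p : ℕ∞} (hp : 1 ≤ p) :
    schattenNorm p (M * N) ≤ c * schattenNorm p M := by
  induction p using ENat.recTopCoe with
  | top =>
    rw [schattenNorm_top, schattenNorm_top]
    have h0 : 0 ≤ twoNorm M := norm_nonneg _
    refine twoNorm_le _ (by positivity) fun x => ?_
    rw [toEuclideanLin_mul_apply, mul_comm c, mul_assoc]
    exact (norm_toEuclideanLin_le M _).trans (by gcongr; exact hN x)
  | coe p =>
    have hp1 : 1 ≤ p := by exact_mod_cast hp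
    have hp0 : p ≠ 0 := by omega
    rw [schattenNorm_natCast _ hp0, schattenNorm_natCast _ hp0]
    obtain ⟨e, f, he, hf, hs⟩ := exists_singular_pairs (M * N)
    -- `N` carries the right singular vectors of `M * N`, rescaled by `c⁻¹`, to a Bessel family.
    have he' := he.map (c⁻¹ • N.toEuclideanLin) fun x => by
      rw [LinearMap.smul_apply, norm_smul, norm_inv, Real.norm_of_nonneg hc.le,
        inv_mul_le_iff₀ hc]
      exact hN x
    have hsum : ∑ j : Fin l, sv (M * N) j ^ p ≤ c ^ p * ∑ j : Fin n, sv M j ^ p := by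
      refine le_trans (le_of_eq ?_)
        (mul_le_mul_of_nonneg_left (sum_abs_inner_pow_le_sum_sv_pow M he' hf hp0)
          (pow_nonneg hc.le p))
      rw [Finset.mul_sum]
      refine Finset.sum_congr rfl fun j _ => ?_
      rw [LinearMap.smul_apply, map_smul, inner_smul_right, ← toEuclideanLin_mul_apply, ← hs,
        abs_of_nonneg (mul_nonneg (inv_nonneg.2 hc.le) (sv_nonneg _ _)), ← mul_pow,
        mul_inv_cancel_left₀ hc.ne']
    have hpos : 0 ≤ ∑ j : Fin n, sv M j ^ p :=
      Finset.sum_nonneg fun j _ => pow_nonneg (sv_nonneg _ _) p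
    refine (Real.rpow_le_rpow (Finset.sum_nonneg fun j _ => pow_nonneg (sv_nonneg _ _) p) hsum
      (by positivity)).trans (le_of_eq ?_)
    rw [Real.mul_rpow (by positivity) hpos, one_div, Real.pow_rpow_inv_natCast hc.le hp0]

theorem schattenNorm_contraction_mul_le (L : Matrix (Fin l) (Fin m) ℝ)
    (hL : ∀ x, ‖L.toEuclideanLin x‖ ≤ ‖x‖) (M : Matrix (Fin m) (Fin n) ℝ) {p : ℕ∞}
    (hp : 1 ≤ p) : schattenNorm p (L * M) ≤ schattenNorm p M := by
  induction p using ENat.recTopCoe with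
  | top =>
    rw [schattenNorm_top, schattenNorm_top]
    refine twoNorm_le _ (norm_nonneg _) fun x => ?_
    rw [toEuclideanLin_mul_apply]
    exact (hL _).trans (norm_toEuclideanLin_le M x)
  | coe p =>
    have hp1 : 1 ≤ p := by exact_mod_cast hp
    have hp0 : p ≠ 0 := by omega
    rw [schattenNorm_natCast _ hp0, schattenNorm_natCast _ hp0]
    obtain ⟨e, f, he, hf, hs⟩ := exists_singular_pairs (L * M)
    have hf' := hf.map Lᵀ.toEuclideanLin (norm_transpose_toEuclideanLin_le L hL)
    refine Real.rpow_le_rpow (Finset.sum_nonneg fun j _ => pow_nonneg (sv_nonneg _ _) p)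
      (le_trans (le_of_eq ?_) (sum_abs_inner_pow_le_sum_sv_pow M he hf' hp0)) (by positivity)
    refine Finset.sum_congr rfl fun j _ => ?_
    rw [inner_toEuclideanLin_left, Matrix.transpose_transpose, ← toEuclideanLin_mul_apply, ← hs,
      abs_of_nonneg (sv_nonneg _ _)]

end SingularVectors

/-! ### Principal angles between the ranges of two projectors -/

section Projectors

variable {m : ℕ}

theorem IsOrthogonalProjector.one_sub {P : Matrix (Fin m) (Fin m) ℝ}
    (hP : IsOrthogonalProjector P) : IsOrthogonalProjector (1 - P) := by
  refine ⟨?_, by rw [Matrix.transpose_sub, hP.2, Matrix.transpose_one]⟩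
  rw [mul_sub, mul_one, sub_mul, one_mul, hP.1, sub_self, sub_zero]

theorem IsOrthogonalProjector.norm_le {P : Matrix (Fin m) (Fin m) ℝ}
    (hP : IsOrthogonalProjector P) (x : EuclideanSpace ℝ (Fin m)) :
    ‖P.toEuclideanLin x‖ ≤ ‖x‖ := by
  have h : ‖P.toEuclideanLin x‖ ^ 2 ≤ ‖x‖ * ‖P.toEuclideanLin x‖ := by
    rw [← real_inner_self_eq_norm_sq, inner_toEuclideanLin_left, hP.2, ← toEuclideanLin_mul_apply,
      hP.1]
    exact real_inner_le_norm _ _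
  by_contra! hlt
  nlinarith [norm_nonneg x]

theorem norm_toEuclideanLin_of_transpose_mul_self {l : ℕ} {Y : Matrix (Fin m) (Fin l) ℝ}
    (hY : Yᵀ * Y = 1) (x : EuclideanSpace ℝ (Fin l)) : ‖Y.toEuclideanLin x‖ = ‖x‖ := by
  refine (sq_eq_sq₀ (norm_nonneg _) (norm_nonneg _)).1 ?_
  rw [← real_inner_self_eq_norm_sq, inner_toEuclideanLin_left, ← toEuclideanLin_mul_apply, hY,
    ← real_inner_self_eq_norm_sq]
  simp

theorem basisMatrix_transpose_mul_self (P : Matrix (Fin m) (Fin m) ℝ) :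
    (basisMatrix P)ᵀ * basisMatrix P = 1 := by
  ext i j
  have h := orthonormal_iff_ite.1 (stdOrthonormalBasis ℝ (rangeOf P)).orthonormal i j
  rw [Submodule.coe_inner, EuclideanSpace.inner_eq_star_dotProduct] at h
  rw [Matrix.one_apply, ← h]
  simp [Matrix.mul_apply, basisMatrix, dotProduct, mul_comm]

theorem mul_basisMatrix {P : Matrix (Fin m) (Fin m) ℝ} (hP : P * P = P) :
    P * basisMatrix P = basisMatrix P := by
  ext i j
  obtain ⟨x, hx⟩ := (stdOrthonormalBasis ℝ (rangeOf P) j).2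
  have h : P.toEuclideanLin (stdOrthonormalBasis ℝ (rangeOf P) j : EuclideanSpace ℝ (Fin m)) =
      (stdOrthonormalBasis ℝ (rangeOf P) j : EuclideanSpace ℝ (Fin m)) := by
    rw [← hx, ← toEuclideanLin_mul_apply, hP]
  exact congrArg (fun z : EuclideanSpace ℝ (Fin m) => z i) h

theorem basisMatrix_mul_transpose {P : Matrix (Fin m) (Fin m) ℝ}
    (hP : IsOrthogonalProjector P) : basisMatrix P * (basisMatrix P)ᵀ = P := by
  set b := stdOrthonormalBasis ℝ (rangeOf P) with hb
  -- The columns of `P` lie in the column space, so expanding them in the basis gives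
  -- `P = Y Yᵀ P`; transposing `P Y = Y` turns this into `P = Y Yᵀ`.
  have h : basisMatrix P * ((basisMatrix P)ᵀ * P) = P := by
    ext i j
    let c : rangeOf P := ⟨P.toEuclideanLin (EuclideanSpace.single j 1), LinearMap.mem_range_self _ _⟩
    have hc : ∀ i, (c : EuclideanSpace ℝ (Fin m)) i = P i j := by
      intro i
      simp [c, Matrix.toLpLin_apply]
    have hsum := congrArg (fun z : rangeOf P => (z : EuclideanSpace ℝ (Fin m)) i) (b.sum_repr' c)
    simp only [hc] at hsum
    rw [← hsum]
    simp [Matrix.mul_apply, basisMatrix, ← hb, PiLp.inner_apply, hc, mul_comm]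
  have h2 : (basisMatrix P)ᵀ * P = (basisMatrix P)ᵀ := by
    have := congrArg Matrix.transpose (mul_basisMatrix hP.1)
    rwa [Matrix.transpose_mul, hP.2] at this
  rwa [h2] at h

theorem finrank_rangeOf (P : Matrix (Fin m) (Fin m) ℝ) :
    Module.finrank ℝ (rangeOf P) = P.rank := by
  rw [Matrix.rank_eq_finrank_range_toLin P (EuclideanSpace.basisFun (Fin m) ℝ).toBasis
    (EuclideanSpace.basisFun (Fin m) ℝ).toBasis, rangeOf, Matrix.toEuclideanLin_eq_toLin_orthonormal]

/-- If the columns of `Y` are an orthonormal basis of `range Q`, then `(1 - P) Y` has the sines of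
the principal angles as singular values: its Gram matrix is `1 - TᵀT`, where `T = Zᵀ Y` has the
cosines as singular values. -/
theorem schattenNorm_sinTheta_eq_basisMatrix {P Q : Matrix (Fin m) (Fin m) ℝ}
    (hP : IsOrthogonalProjector P) (h : Q.rank ≤ P.rank) {p : ℕ∞} (hp : 1 ≤ p) :
    schattenNorm p (sinTheta P Q) = schattenNorm p ((1 - P) * basisMatrix Q) := by
  set Z := basisMatrix P
  set Y := basisMatrix Q
  set T := Zᵀ * Y with hT
  have hYY : Yᵀ * Y = 1 := basisMatrix_transpose_mul_self Q
  have hgram : ((1 - P) * Y)ᵀ * ((1 - P) * Y) = 1 - Tᵀ * T := by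
    rw [Matrix.transpose_mul, hP.one_sub.2, Matrix.mul_assoc, ← Matrix.mul_assoc (1 - P),
      hP.one_sub.1, Matrix.sub_mul, Matrix.one_mul, Matrix.mul_sub, hYY, hT, Matrix.transpose_mul,
      Matrix.transpose_transpose, Matrix.mul_assoc, ← Matrix.mul_assoc Z,
      basisMatrix_mul_transpose hP]
  have hinner : ∀ x y, ⟪((1 - P) * Y).toEuclideanLin x, ((1 - P) * Y).toEuclideanLin y⟫ =
      ⟪x, y⟫ - ⟪T.toEuclideanLin x, T.toEuclideanLin y⟫ := by
    intro x y
    rw [inner_toEuclideanLin_left, ← toEuclideanLin_mul_apply, hgram, inner_toEuclideanLin_left,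
      ← toEuclideanLin_mul_apply, map_sub, LinearMap.sub_apply, inner_sub_right]
    simp [Matrix.toLpLin_apply]
  obtain ⟨v, hv, hs⟩ := exists_basis_singular T
  have hdim : min P.rank Q.rank = Module.finrank ℝ (rangeOf Q) := by
    rw [finrank_rangeOf, min_eq_right h]
  have hnorm : ∀ j : Fin (Module.finrank ℝ (rangeOf Q)),
      ‖((1 - P) * Y).toEuclideanLin (v j)‖ = Real.sin (principalAngle P Q j) := by
    intro j
    rw [principalAngle, Real.sin_arccos, ← hs j, ← real_inner_self_eq_norm_sq]
    have := hinner (v j) (v j)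
    rw [real_inner_self_eq_norm_sq, real_inner_self_eq_norm_sq (v j), v.norm_eq_one, one_pow]
      at this
    rw [← this, Real.sqrt_sq (norm_nonneg _)]
  have horth : Pairwise fun i j =>
      ⟪((1 - P) * Y).toEuclideanLin (v i), ((1 - P) * Y).toEuclideanLin (v j)⟫ = 0 := by
    intro i j hij
    rw [hinner, v.inner_eq_zero hij, hv hij, sub_zero]
  rw [sinTheta]
  generalize min P.rank Q.rank = d at hdim
  subst hdim
  have hdiag : ∀ j, (Matrix.diagonal fun j : Fin (Module.finrank ℝ (rangeOf Q)) =>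
      Real.sin (principalAngle P Q j)).toEuclideanLin (EuclideanSpace.basisFun _ ℝ j) =
      Real.sin (principalAngle P Q j) • EuclideanSpace.basisFun _ ℝ j := by
    intro j
    ext i
    simp [Matrix.toLpLin_apply]
  refine schattenNorm_eq_of_orthogonal_images (EuclideanSpace.basisFun _ ℝ) v ?_ horth ?_ hp
  · intro i j hij
    rw [hdiag, hdiag, inner_smul_left, inner_smul_right,
      (EuclideanSpace.basisFun _ ℝ).inner_eq_zero hij]
    simp
  · intro j
    rw [hdiag, hnorm, norm_smul, OrthonormalBasis.norm_eq_one, mul_one, ← hnorm, norm_norm]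

/-- Passing from an orthonormal basis `Y` of `range Q` to `Q = Y Yᵀ` does not change the norm, since
`(1 - P) Q = ((1 - P) Y) Yᵀ` and `(1 - P) Y = ((1 - P) Q) Y`, where `Y` and `Yᵀ` are
contractions. -/
theorem schattenNorm_sinTheta {P Q : Matrix (Fin m) (Fin m) ℝ}
    (hP : IsOrthogonalProjector P) (hQ : IsOrthogonalProjector Q) (h : Q.rank ≤ P.rank)
    {p : ℕ∞} (hp : 1 ≤ p) :
    schattenNorm p (sinTheta P Q) = schattenNorm p ((1 - P) * Q) := by
  rw [schattenNorm_sinTheta_eq_basisMatrix hP h hp]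
  have hYY := basisMatrix_transpose_mul_self Q
  have hY := fun x => (norm_toEuclideanLin_of_transpose_mul_self hYY x).le
  apply le_antisymm
  · have := schattenNorm_mul_le ((1 - P) * Q) (basisMatrix Q) one_pos
      (fun x => by simpa using hY x) hp
    rwa [Matrix.mul_assoc, mul_basisMatrix hQ.1, one_mul] at this
  · have := schattenNorm_mul_le ((1 - P) * basisMatrix Q) (basisMatrix Q)ᵀ one_pos
      (fun x => by simpa using norm_transpose_toEuclideanLin_le _ hY x) hp
    rwa [Matrix.mul_assoc, basisMatrix_mul_transpose hQ, one_mul] at this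

end Projectors

/-! ### Truncated singular value decompositions -/

section Truncation

variable {m n k : ℕ}

theorem leadingCols_transpose_mul_self {l : ℕ} (h : k ≤ l) {U : Matrix (Fin l) (Fin l) ℝ}
    (hU : U ∈ Matrix.orthogonalGroup (Fin l) ℝ) :
    (leadingCols h U)ᵀ * leadingCols h U = 1 := by
  have hU' : Uᵀ * U = 1 := (Matrix.mem_orthogonalGroup_iff' _ _).1 hU
  ext i j
  have := congrFun (congrFun hU' (Fin.castLE h i)) (Fin.castLE h j)
  simpa [Matrix.mul_apply, leadingCols, Matrix.one_apply] using this

theorem transpose_leadingCols_mul (hm : k ≤ m) (hn : k ≤ n)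
    (A : Matrix (Fin m) (Fin n) ℝ) {U : Matrix (Fin m) (Fin m) ℝ} {V : Matrix (Fin n) (Fin n) ℝ}
    (hSVD : IsFullSVD A U V) :
    (leadingCols hm U)ᵀ * A =
      Matrix.diagonal (fun j : Fin k => sv A j) * (leadingCols hn V)ᵀ := by
  have hU' : Uᵀ * U = 1 :=
    (Matrix.mem_orthogonalGroup_iff' _ _).1 hSVD.left_orthogonal
  have h1 : Uᵀ * A = sigmaMatrix A * Vᵀ := by
    conv_lhs => rw [hSVD.decomposition]
    rw [Matrix.mul_assoc, ← Matrix.mul_assoc, hU', Matrix.one_mul]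
  ext i j
  have h2 := congrFun (congrFun h1 (Fin.castLE hm i)) j
  rw [Matrix.diagonal_mul]
  refine Eq.trans (by simp [Matrix.mul_apply, leadingCols]) (h2.trans ?_)
  rw [Matrix.mul_apply, Finset.sum_eq_single (Fin.castLE hn i)]
  · simp [sigmaMatrix, leadingCols]
  · intro b _ hb
    have : (i : ℕ) ≠ (b : ℕ) := fun h => hb (Fin.ext (by simpa using h.symm))
    simp [sigmaMatrix, this]
  · simp

theorem mul_leadingCols (hm : k ≤ m) (hn : k ≤ n)
    (A : Matrix (Fin m) (Fin n) ℝ) {U : Matrix (Fin m) (Fin m) ℝ} {V : Matrix (Fin n) (Fin n) ℝ}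
    (hSVD : IsFullSVD A U V) :
    A * leadingCols hn V = leadingCols hm U * Matrix.diagonal (fun j : Fin k => sv A j) := by
  have hV' : Vᵀ * V = 1 :=
    (Matrix.mem_orthogonalGroup_iff' _ _).1 hSVD.right_orthogonal
  have h1 : A * V = U * sigmaMatrix A := by
    conv_lhs => rw [hSVD.decomposition]
    rw [Matrix.mul_assoc, hV', Matrix.mul_one]
  ext i j
  have h2 := congrFun (congrFun h1 i) (Fin.castLE hn j)
  rw [Matrix.mul_diagonal]
  refine Eq.trans (by simp [Matrix.mul_apply, leadingCols]) (h2.trans ?_)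
  rw [Matrix.mul_apply, Finset.sum_eq_single (Fin.castLE hm j)]
  · simp [sigmaMatrix, leadingCols]
  · intro b _ hb
    have : (b : ℕ) ≠ (j : ℕ) := fun h => hb (Fin.ext (by simpa using h))
    simp [sigmaMatrix, this]
  · simp

theorem mul_truncationPinv (hm : k ≤ m) (hn : k ≤ n) (A : Matrix (Fin m) (Fin n) ℝ)
    {U : Matrix (Fin m) (Fin m) ℝ} {V : Matrix (Fin n) (Fin n) ℝ}
    (hSVD : IsFullSVD A U V) (hpos : ∀ j : Fin k, sv A j ≠ 0) :
    A * truncationPinv hm hn A U V = leadingCols hm U * (leadingCols hm U)ᵀ := by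
  have hD : Matrix.diagonal (fun j : Fin k => sv A j) *
      Matrix.diagonal (fun j : Fin k => (sv A j)⁻¹) = 1 := by
    rw [Matrix.diagonal_mul_diagonal, ← Matrix.diagonal_one]
    congr 1
    funext j
    exact mul_inv_cancel₀ (hpos j)
  rw [truncationPinv, ← Matrix.mul_assoc, ← Matrix.mul_assoc, mul_leadingCols hm hn A hSVD,
    Matrix.mul_assoc (leadingCols hm U), hD, Matrix.mul_one]

theorem mul_transpose_leadingCols_mul (hm : k ≤ m) (hn : k ≤ n) (A : Matrix (Fin m) (Fin n) ℝ)
    {U : Matrix (Fin m) (Fin m) ℝ} {V : Matrix (Fin n) (Fin n) ℝ} (hSVD : IsFullSVD A U V) :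
    leadingCols hm U * (leadingCols hm U)ᵀ * A = truncation hm hn A U V := by
  rw [Matrix.mul_assoc, transpose_leadingCols_mul hm hn A hSVD, truncation, Matrix.mul_assoc]

theorem dominantProjector_eq (hm : k ≤ m) (hn : k ≤ n) (A : Matrix (Fin m) (Fin n) ℝ)
    {U : Matrix (Fin m) (Fin m) ℝ} {V : Matrix (Fin n) (Fin n) ℝ}
    (hSVD : IsFullSVD A U V) (hpos : ∀ j : Fin k, sv A j ≠ 0) :
    dominantProjector hm hn A U V = leadingCols hm U * (leadingCols hm U)ᵀ := by
  rw [dominantProjector, ← mul_transpose_leadingCols_mul hm hn A hSVD, Matrix.mul_assoc,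
    mul_truncationPinv hm hn A hSVD hpos, Matrix.mul_assoc, ← Matrix.mul_assoc (leadingCols hm U)ᵀ,
    leadingCols_transpose_mul_self hm hSVD.left_orthogonal, Matrix.one_mul]

theorem norm_diagonal_toEuclideanLin_le {d : Fin k → ℝ} {c : ℝ} (hc : 0 ≤ c)
    (hd : ∀ j, |d j| ≤ c) (x : EuclideanSpace ℝ (Fin k)) :
    ‖(Matrix.diagonal d).toEuclideanLin x‖ ≤ c * ‖x‖ := by
  refine (sq_le_sq₀ (norm_nonneg _) (by positivity)).1 ?_
  rw [mul_pow, EuclideanSpace.real_norm_sq_eq, EuclideanSpace.real_norm_sq_eq, Finset.mul_sum]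
  refine Finset.sum_le_sum fun j _ => ?_
  simp only [Matrix.toLpLin_apply, Matrix.mulVec_diagonal, mul_pow]
  refine mul_le_mul_of_nonneg_right ?_ (sq_nonneg _)
  rw [← sq_abs]
  exact pow_le_pow_left₀ (abs_nonneg _) (hd j) 2

theorem norm_truncationPinv_le (hm : k ≤ m) (hn : k ≤ n) (A : Matrix (Fin m) (Fin n) ℝ)
    {U : Matrix (Fin m) (Fin m) ℝ} {V : Matrix (Fin n) (Fin n) ℝ}
    (hU : U ∈ Matrix.orthogonalGroup (Fin m) ℝ) (hV : V ∈ Matrix.orthogonalGroup (Fin n) ℝ)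
    (hpos : 0 < sv A (k - 1)) (x : EuclideanSpace ℝ (Fin m)) :
    ‖(truncationPinv hm hn A U V).toEuclideanLin x‖ ≤ (sv A (k - 1))⁻¹ * ‖x‖ := by
  rw [truncationPinv, toEuclideanLin_mul_apply, toEuclideanLin_mul_apply,
    norm_toEuclideanLin_of_transpose_mul_self (leadingCols_transpose_mul_self hn hV)]
  refine (norm_diagonal_toEuclideanLin_le (inv_nonneg.2 hpos.le) (fun j => ?_) _).trans ?_
  · have hj : sv A (k - 1) ≤ sv A j :=
      LinearMap.singularValues_antitone _ (Nat.le_sub_one_of_lt j.2)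
    rw [abs_of_nonneg (inv_nonneg.2 (sv_nonneg A j))]
    exact inv_anti₀ hpos hj
  · gcongr
    exact norm_transpose_toEuclideanLin_le _
      (fun y => (norm_toEuclideanLin_of_transpose_mul_self
        (leadingCols_transpose_mul_self hm hU) y).le) x

end Truncation

end SchattenSin

theorem mainTheorem9 {m n k : ℕ} (hk : 1 ≤ k) (hm : k ≤ m) (hn : k ≤ n)
    (A : Matrix (Fin m) (Fin n) ℝ)
    (hgap : SchattenSin.sv A k < SchattenSin.sv A (k - 1))
    (U : Matrix (Fin m) (Fin m) ℝ) (V : Matrix (Fin n) (Fin n) ℝ)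
    (hSVD : SchattenSin.IsFullSVD A U V)
    (P : Matrix (Fin m) (Fin m) ℝ) (hP : SchattenSin.IsOrthogonalProjector P)
    (hrank_ge : k ≤ P.rank) (hrank_lt : P.rank + k < m)
    (p : ℕ∞) (hp : 1 ≤ p) :
    SchattenSin.sv A (k - 1) *
          SchattenSin.schattenNorm p
            (SchattenSin.sinTheta P (SchattenSin.dominantProjector hm hn A U V)) ≤
        SchattenSin.schattenNorm p ((1 - P) * A) ∧
      SchattenSin.schattenNorm p ((1 - P) * A) ≤
        SchattenSin.twoNorm A *
            SchattenSin.schattenNorm p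
              (SchattenSin.sinTheta P (SchattenSin.dominantProjector hm hn A U V)) +
          SchattenSin.schattenNorm p (A - SchattenSin.truncation hm hn A U V) := by
  open SchattenSin in
  have hpos : 0 < sv A (k - 1) := (sv_nonneg A k).trans_lt hgap
  have hne : ∀ j : Fin k, sv A j ≠ 0 := fun j =>
    (hpos.trans_le (LinearMap.singularValues_antitone _ (Nat.le_sub_one_of_lt j.2))).ne'
  have hW := leadingCols_transpose_mul_self hm hSVD.left_orthogonal
  set W := leadingCols hm U
  set Q := dominantProjector hm hn A U V
  have hQW : Q = W * Wᵀ := dominantProjector_eq hm hn A hSVD hne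
  have hQ : IsOrthogonalProjector Q := by
    rw [hQW]
    constructor
    · rw [Matrix.mul_assoc, ← Matrix.mul_assoc Wᵀ, hW, Matrix.one_mul]
    · rw [Matrix.transpose_mul, Matrix.transpose_transpose]
  have hQrank : Q.rank ≤ P.rank := by
    rw [hQW]
    exact ((Matrix.rank_mul_le_left _ _).trans (Matrix.rank_le_width _)).trans hrank_ge
  have hQA : Q * A = truncation hm hn A U V := by
    rw [hQW, mul_transpose_leadingCols_mul hm hn A hSVD]
  have hApinv : A * truncationPinv hm hn A U V = Q := by
    rw [hQW, mul_truncationPinv hm hn A hSVD hne]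
  rw [schattenNorm_sinTheta hP hQ hQrank hp]
  constructor
  · have h := schattenNorm_mul_le ((1 - P) * A) (truncationPinv hm hn A U V) (inv_pos.2 hpos)
      (norm_truncationPinv_le hm hn A hSVD.left_orthogonal hSVD.right_orthogonal hpos) hp
    rwa [Matrix.mul_assoc, hApinv, ← div_eq_inv_mul, le_div_iff₀ hpos, mul_comm] at h
  · have hdecomp : (1 - P) * A = (1 - P) * Q * A + (1 - P) * (A - truncation hm hn A U V) := by
      rw [Matrix.mul_assoc, hQA, ← Matrix.mul_add, add_sub_cancel]
    rw [hdecomp]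
    refine (schattenNorm_add_le _ _ hp).trans (add_le_add ?_ ?_)
    · exact schattenNorm_mul_le _ _ (hpos.trans_le (sv_le_twoNorm A _))
        (norm_toEuclideanLin_le A) hp
    · exact schattenNorm_contraction_mul_le _ hP.one_sub.norm_le _ hp
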